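/- **Setting.** Let $\Omega\subset\prod_{i=1}^d[A_i,B_i]\subset\mathbb R^d$ be compact, with the metric $|x-y|=\max_i|x_i-y_i|$ and Borel $\sigma$-algebra $\mathcal A$. Let $K$ be a Markov transition kernel on $\Omega$, reversible with respect to a probability measure $\pi$ that is absolutely continuous with respect to Lebesgue measure, with density $\rho$ (extended by $0$ outside $\Omega$; $\pi$ is also regarded as a measure on $\mathbb R^d$). Write $\mu|_S(\cdot)=\mu(S\cap\cdot)/\mu(S)$ and $\|\mu-\nu\|_{TV}=\sup_{A\in\mathcal A}(\mu(A)-\nu(A))$. The mixing time of a kernel $K$ with stationary distribution $\pi$ is $\tau=\inf\{t\in\mathbb N:\sup_{x}\|K^t(x,\cdot)-\pi\|_{TV}<\tfrac14\}\in\mathbb N\cup\{\infty\}$. A Markov kernel $\widehat K$ on a measurable space $\widehat\Omega$ with stationary distribution $\widehat\pi$ is a *lift* of $K$ if there is a measurable $f:\widehat\Omega\to\Omega$ such that, for every $S\in\mathcal A$ with $\pi(S)>0$, if $\widehat X_0\sim\widehat\pi|_{f^{-1}(S)}$ and $X_0\sim\pi|_S$, then $f(\widehat X_1)$ and $X_1$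 have the same law, where $\widehat X_1$ and $X_1$ are obtained by one step of $\widehat K$ and $K$. **Assumptions.** 1. For every $x\in\Omega$ there are $\alpha_x\in[\frac12,1)$, depending measurably on $x$, a countable family $\mathcal U_x\subset\mathcal A$ and a probability distribution $\{K_{x,U}\}_{U\in\mathcal U_x}$ with $K(x,\cdot)=\alpha_x\delta_x+(1-\alpha_x)\sum_{U\in\mathcal U_x}K_{x,U}\,\pi|_U$. With $\mathcal B=\bigcup_{x\in\Omega}\{U\in\mathcal U_x:K_{x,U}>0\}$, one has $\pi_*:=\inf_{U\in\mathcal B}\pi(U)>0$. 2. For constants $\beta,\gamma\in(0,1]$, at least one of the following holds: (a) for all measurable $S\subset\Omega$ with $\pi(S)\le\beta$, $$\int_S(1-\alpha_x)\sum_{U\in\mathcal U_x}K_{x,U}\,\pi|_U(dx)+\sup_{x\in S}\alpha_x\le\gamma ,$$ where $\pi|_U(dx)=\mathbf 1_U(x)\,\pi(dx)/\pi(U)$, and moreover every non-empty relatively open subset of $\Omega$ has positive $\pi$-measure; (b) the same inequality holds for all such $S$ with $1-\gamma$ in place of $\gamma$ on the right-hand side. 3. For every $\epsilon>0$ there is $\delta>0$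 such that $|x-y|\le\delta$ implies $\|K(x,\cdot)-K(y,\cdot)\|_{TV}\le\min(\alpha_x,\alpha_y)+\epsilon$. 4. For $N\in\mathbb N$ let $\Omega^{(N)}$ be the set of points $N^{-1}(z_1,\dots,z_d)$ with $z_i\in\mathbb Z$, $NA_i-2\le z_i\le NB_i+2$; for $S\subset\Omega^{(N)}$ let $\mathcal P^{(N)}(S)=\bigcup_{x\in S}\prod_i[x_i-\frac1{2N},x_i+\frac1{2N}]$; for $x\in\Omega^{(N)}$ let $\pi^{(N)}(x)=\int_{\mathcal P^{(N)}(\{x\})}\rho(y)\,dy$; and for general $S$ let $\pi^{(N)}(S)=\sum_{x\in S\cap\Omega^{(N)}}\pi^{(N)}(x)$. Let $\mathcal R_\epsilon$ be the set of boxes $\prod_i[a_i,b_i]$ with all $b_i-a_i\ge\epsilon$, and $\mathcal H_{\epsilon,m}$ the collection of all sets $\bigcup_{j=1}^kR_j$ and $(\bigcup_{j=1}^kR_j)^c$ with $1\le k\le m$ and, for each $j$, $R_j\in\mathcal R_\epsilon$ or $R_j^c\in\mathcal R_\epsilon$. Fix an arbitrary extension of $\alpha_x,\mathcal U_x,K_{x,U}$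 to points $x\notin\Omega$. For all $0<\epsilon<1$ and $m\in\mathbb N$, the following four quantities tend to $0$ as $N\to\infty$: $$\theta^{(1)}=\sup_{S\in\mathcal H_{\epsilon,m}}|\pi^{(N)}(S)-\pi(S)|,\quad \theta^{(2)}=\sup_{S\in\mathcal B}|\pi^{(N)}(S)-\pi(S)|,\quad \theta^{(3)}=\sup_{S\in\mathcal B}d_{\mathrm{Prok}}(\pi^{(N)}|_S,\pi|_S),$$ with $d_{\mathrm{Prok}}$ the Prokhorov distance, and (with $0/0=0$, and $S^c=\Omega^{(N)}\setminus S$) $$\theta^{(4)}=\sup_{S\subset\Omega^{(N)}}\frac1{\pi(\mathcal P^{(N)}(S))}\Big|\sum_{x\in S,\,y\in S^c}(1-\alpha_x)\pi^{(N)}(x)\pi^{(N)}(y)\sum_{U\in\mathcal U_x,\,U\ni y}\frac{K_{x,U}}{\pi(U)}-\int_{\mathcal P^{(N)}(S)}(1-\alpha_x)\sum_{U\in\mathcal U_x}K_{x,U}\frac{\pi(U\cap\mathcal P^{(N)}(S^c))}{\pi(U)}\rho(x)\,dx\Big| .$$ **Theorem.** Under these assumptions, let $\tau$ be the mixing time of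 $K$. Then every lift $\widehat K$ of $K$ has a mixing time $\widehat\tau$ that satisfies $$\widehat\tau\ \ge\ \frac{\sqrt\gamma}{32\sqrt{\log\left(\frac4{\pi_*}\right)\log\left(\frac2{\sqrt\beta}\right)}}\ \sqrt\tau .$$ (In particular $\widehat\tau=\infty$ if $\tau=\infty$.) -/

import Mathlib

open MeasureTheory ProbabilityTheory Filter Topology Set
open scoped ENNReal

noncomputable section

namespace LiftedChains

/-! ### Total variation, mixing times and lifts on general state spaces -/

/-- Total variation distance `sup_A (μ(A) - ν(A))` over measurable sets `A`. The subtraction is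
truncated at `0`, which does not affect the supremum because `A = ∅` is allowed. -/
def tvDist {S : Type*} [MeasurableSpace S] (μ ν : Measure S) : ℝ≥0∞ :=
  ⨆ (A : Set S) (_ : MeasurableSet A), (μ A - ν A)

/-- The mixing profile `τ(ε) = inf {t : sup_x ‖K^t(x, ·) - π‖_TV < ε}`, equal to `⊤` when no such
`t` exists. Here `K ^ t` is the `t`-step transition kernel. -/
def mixingProfile {S : Type*} [MeasurableSpace S] (K : Kernel S S) (π : Measure S)
    (ε : ℝ≥0∞) : ℕ∞ :=
  ⨅ (t : ℕ) (_ : (⨆ x : S, tvDist ((K ^ t) x) π) < ε), (t : ℕ∞)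

/-- The mixing time `τ(1/4)`. -/
def mixingTime {S : Type*} [MeasurableSpace S] (K : Kernel S S) (π : Measure S) : ℕ∞ :=
  mixingProfile K π (1 / 4)

/-- The kernel `K'` with stationary distribution `π'` is a lift of the kernel `K` with stationary
distribution `π`: for some measurable `f` and all measurable `A` with `π(A) > 0`, if `X'₀` has law
`π'` conditioned on `f⁻¹(A)` and `X₀` has law `π` conditioned on `A`, then `f(X'₁)` and `X₁` have
the same law. -/
def IsLift {S S' : Type*} [MeasurableSpace S] [MeasurableSpace S']
    (K : Kernel S S) (π : Measure S) (K' : Kernel S' S') (π' : Measure S') : Prop :=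
  ∃ f : S' → S, Measurable f ∧
    ∀ A : Set S, MeasurableSet A → 0 < π A →
      Measure.map f (Measure.bind (ProbabilityTheory.cond π' (f ⁻¹' A)) K') =
        Measure.bind (ProbabilityTheory.cond π A) K

section Representation

variable {d : ℕ} {Ω : Set (Fin d → ℝ)}

/-! ### Mixture representations

The data are holding probabilities `α x`, countable families `𝒰 x` of measurable subsets of `Ω`,
and weights `w x U` (written `K_{x,U}` in the usual notation). They are functions of `x ∈ ℝ^d`, but
are only constrained for `x ∈ Ω`; the values at grid points outside `Ω` are an arbitrary extension.
-/

/-- `K(x, ·) = α_x δ_x + (1 - α_x) ∑_{U ∈ 𝒰_x} w_{x,U} π|_U` for every `x ∈ Ω`, where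
`α_x ∈ [1/2, 1)` depends measurably on `x`, `𝒰_x` is a countable family of measurable sets and
`w_{x,·}` is a probability distribution on it. -/
structure IsMixture (K : Kernel Ω Ω) (π : Measure Ω) (α : (Fin d → ℝ) → ℝ)
    (𝒰 : (Fin d → ℝ) → Set (Set Ω)) (w : (Fin d → ℝ) → Set Ω → ℝ≥0∞) : Prop where
  holding_mem : ∀ x : Ω, α x ∈ Set.Ico (1 / 2 : ℝ) 1
  holding_measurable : Measurable fun x : Ω => α x
  countable : ∀ x : Ω, (𝒰 x).Countable
  measurable : ∀ x : Ω, ∀ U ∈ 𝒰 x, MeasurableSet U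
  weights_sum : ∀ x : Ω, ∑' U : 𝒰 x, w x U = 1
  kernel_eq : ∀ x : Ω, K x = ENNReal.ofReal (α x) • Measure.dirac x +
    ENNReal.ofReal (1 - α x) •
      Measure.sum fun U : 𝒰 x => w x U • ProbabilityTheory.cond π (U : Set Ω)

/-- The collection of the sets `U` that occur in the representation with positive weight. -/
def usedSets (𝒰 : (Fin d → ℝ) → Set (Set Ω)) (w : (Fin d → ℝ) → Set Ω → ℝ≥0∞) : Set (Set Ω) :=
  {U | ∃ x : Ω, U ∈ 𝒰 x ∧ 0 < w x U}

/-- `π_* = inf {π(U) : U occurs in the representation with positive weight}`. -/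
def piStar (π : Measure Ω) (𝒰 : (Fin d → ℝ) → Set (Set Ω)) (w : (Fin d → ℝ) → Set Ω → ℝ≥0∞) :
    ℝ≥0∞ :=
  ⨅ U ∈ usedSets 𝒰 w, π U

/-- For all measurable `S` with `π(S) ≤ β`,
`∫_S (1 - α_x) ∑_{U ∈ 𝒰_x} w_{x,U} π|_U(dx) + sup_{x ∈ S} α_x ≤ c`,
where `π|_U(dx) = 1_U(x) π(dx) / π(U)`. -/
def SmallSetBound (π : Measure Ω) (α : (Fin d → ℝ) → ℝ) (𝒰 : (Fin d → ℝ) → Set (Set Ω))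
    (w : (Fin d → ℝ) → Set Ω → ℝ≥0∞) (β c : ℝ) : Prop :=
  ∀ S : Set Ω, MeasurableSet S → π S ≤ ENNReal.ofReal β →
    (∫⁻ x in S, ENNReal.ofReal (1 - α x) *
        (∑' U : {U : Set Ω // U ∈ 𝒰 x ∧ x ∈ U}, w x U / π U) ∂π) +
      (⨆ x ∈ S, ENNReal.ofReal (α x)) ≤ ENNReal.ofReal c

/-- For every `ε > 0` there is `δ > 0` such that `|x - y| ≤ δ` implies
`‖K(x, ·) - K(y, ·)‖_TV ≤ min(α_x, α_y) + ε`; the metric is the maximum metric. -/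
def IsTVContinuous (K : Kernel Ω Ω) (α : (Fin d → ℝ) → ℝ) : Prop :=
  ∀ ε : ℝ, 0 < ε → ∃ δ : ℝ, 0 < δ ∧ ∀ x y : Ω, dist x y ≤ δ →
    tvDist (K x) (K y) ≤ ENNReal.ofReal (min (α x) (α y) + ε)

/-! ### Discretization -/

/-- `π`, seen as a measure on `ℝ^d`. -/
def ambient (π : Measure Ω) : Measure (Fin d → ℝ) := Measure.map Subtype.val π

/-- The grid `Ω^(N)`: points `z / N`, `z ∈ ℤ^d`, with `N A_i - 2 ≤ z_i ≤ N B_i + 2`. -/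
def grid (A B : Fin d → ℝ) (N : ℕ) : Set (Fin d → ℝ) :=
  {x | ∃ z : Fin d → ℤ, (∀ i, N * A i - 2 ≤ z i ∧ (z i : ℝ) ≤ N * B i + 2) ∧
    x = fun i => (z i : ℝ) / N}

/-- The box `∏_i [x_i - 1/(2N), x_i + 1/(2N)]`. -/
def cell (N : ℕ) (x : Fin d → ℝ) : Set (Fin d → ℝ) :=
  Set.pi Set.univ fun i => Set.Icc (x i - 1 / (2 * N)) (x i + 1 / (2 * N))

/-- The covering map `P^(N)`: the union of the boxes around the points of `S`. -/
def cover (N : ℕ) (S : Set (Fin d → ℝ)) : Set (Fin d → ℝ) := ⋃ x ∈ S, cell N x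

/-- `π^(N)({x})`, the integral of the density of `π` over the box around `x`. -/
def gridMass (π : Measure Ω) (N : ℕ) (x : Fin d → ℝ) : ℝ≥0∞ := ambient π (cell N x)

/-- The discretized measure `π^(N)`, seen as a measure on `ℝ^d` carried by the grid. -/
def gridMeasure (π : Measure Ω) (A B : Fin d → ℝ) (N : ℕ) : Measure (Fin d → ℝ) :=
  Measure.sum fun x : grid A B N => gridMass π N x • Measure.dirac (x : Fin d → ℝ)

/-- Boxes all of whose side lengths are at least `ε`. -/
def largeBoxes (d : ℕ) (ε : ℝ) : Set (Set (Fin d → ℝ)) :=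
  {R | ∃ a b : Fin d → ℝ, (∀ i, ε ≤ b i - a i) ∧
    R = Set.pi Set.univ fun i => Set.Icc (a i) (b i)}

/-- The collection `H_{ε,m}`: unions, and complements of unions, of between `1` and `m` sets each
of which is a large box or the complement of one. -/
def simpleSets (d : ℕ) (ε : ℝ) (m : ℕ) : Set (Set (Fin d → ℝ)) :=
  {S | ∃ k : ℕ, 1 ≤ k ∧ k ≤ m ∧ ∃ R : Fin k → Set (Fin d → ℝ),
    (∀ j, R j ∈ largeBoxes d ε ∨ (R j)ᶜ ∈ largeBoxes d ε) ∧
      (S = ⋃ j, R j ∨ S = (⋃ j, R j)ᶜ)}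

/-- `|a - b|` for nonnegative extended reals. -/
def absDiff (a b : ℝ≥0∞) : ℝ≥0∞ := (a - b) + (b - a)

/-- `θ^(1)`: error on the sets of `H_{ε,m}`. -/
def theta1 (π : Measure Ω) (A B : Fin d → ℝ) (ε : ℝ) (m N : ℕ) : ℝ≥0∞ :=
  ⨆ S ∈ simpleSets d ε m, absDiff (gridMeasure π A B N S) (ambient π S)

/-- `θ^(2)`: error on the sets of the representation. -/
def theta2 (π : Measure Ω) (A B : Fin d → ℝ) (𝒰 : (Fin d → ℝ) → Set (Set Ω))
    (w : (Fin d → ℝ) → Set Ω → ℝ≥0∞) (N : ℕ) : ℝ≥0∞ :=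
  ⨆ U ∈ usedSets 𝒰 w, absDiff (gridMeasure π A B N (Subtype.val '' U)) (π U)

/-- `θ^(3)`: Prokhorov distance of the restrictions to the sets of the representation. -/
def theta3 (π : Measure Ω) (A B : Fin d → ℝ) (𝒰 : (Fin d → ℝ) → Set (Set Ω))
    (w : (Fin d → ℝ) → Set Ω → ℝ≥0∞) (N : ℕ) : ℝ≥0∞ :=
  ⨆ U ∈ usedSets 𝒰 w, levyProkhorovEDist
    (ProbabilityTheory.cond (gridMeasure π A B N) (Subtype.val '' U))
    (ProbabilityTheory.cond (ambient π) (Subtype.val '' U))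

/-- The discretized flow out of `S ⊆ Ω^(N)`: the sum over `x ∈ S` and `y ∈ Ω^(N) \ S` of
`(1 - α_x) π^(N)(x) π^(N)(y) ∑_{U ∈ 𝒰_x, U ∋ y} w_{x,U} / π(U)`. -/
def gridFlow (π : Measure Ω) (A B : Fin d → ℝ) (α : (Fin d → ℝ) → ℝ)
    (𝒰 : (Fin d → ℝ) → Set (Set Ω)) (w : (Fin d → ℝ) → Set Ω → ℝ≥0∞) (N : ℕ)
    (S : Set (Fin d → ℝ)) : ℝ≥0∞ :=
  ∑' x : S, ∑' y : (grid A B N \ S : Set (Fin d → ℝ)),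
    ENNReal.ofReal (1 - α x) * gridMass π N x * gridMass π N y *
      ∑' U : {U : Set Ω // U ∈ 𝒰 x ∧ (y : Fin d → ℝ) ∈ Subtype.val '' U}, w x U / π U

/-- The flow of `K` from the box cover of `S` to the box cover of `Ω^(N) \ S`: the integral over
`P^(N)(S)` of `(1 - α_x) ∑_{U ∈ 𝒰_x} w_{x,U} π(U ∩ P^(N)(Ω^(N) \ S)) / π(U)` against `π`. -/
def coverFlow (π : Measure Ω) (A B : Fin d → ℝ) (α : (Fin d → ℝ) → ℝ)
    (𝒰 : (Fin d → ℝ) → Set (Set Ω)) (w : (Fin d → ℝ) → Set Ω → ℝ≥0∞) (N : ℕ)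
    (S : Set (Fin d → ℝ)) : ℝ≥0∞ :=
  ∫⁻ x in (Subtype.val ⁻¹' cover N S : Set Ω), ENNReal.ofReal (1 - α x) *
    (∑' U : 𝒰 x, w x U *
      (π ((U : Set Ω) ∩ Subtype.val ⁻¹' cover N (grid A B N \ S)) / π U)) ∂π

/-- `θ^(4)`: relative Riemann-sum error of the flow, with the convention `0 / 0 = 0`. -/
def theta4 (π : Measure Ω) (A B : Fin d → ℝ) (α : (Fin d → ℝ) → ℝ)
    (𝒰 : (Fin d → ℝ) → Set (Set Ω)) (w : (Fin d → ℝ) → Set Ω → ℝ≥0∞) (N : ℕ) : ℝ≥0∞ :=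
  ⨆ (S : Set (Fin d → ℝ)) (_ : S ⊆ grid A B N),
    absDiff (gridFlow π A B α 𝒰 w N S) (coverFlow π A B α 𝒰 w N S) / ambient π (cover N S)

/-- All four discretization errors tend to `0` as `N → ∞`, for all fixed `0 < ε < 1` and `m`. -/
def DiscretizationErrorsVanish (π : Measure Ω) (A B : Fin d → ℝ) (α : (Fin d → ℝ) → ℝ)
    (𝒰 : (Fin d → ℝ) → Set (Set Ω)) (w : (Fin d → ℝ) → Set Ω → ℝ≥0∞) : Prop :=
  (∀ (ε : ℝ) (m : ℕ), 0 < ε → ε < 1 → Tendsto (fun N => theta1 π A B ε m N) atTop (𝓝 0)) ∧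
  Tendsto (fun N => theta2 π A B 𝒰 w N) atTop (𝓝 0) ∧
  Tendsto (fun N => theta3 π A B 𝒰 w N) atTop (𝓝 0) ∧
  Tendsto (fun N => theta4 π A B α 𝒰 w N) atTop (𝓝 0)

end Representation

end LiftedChains

end

/-! A lift cannot enlarge the flow between sets of `Ω`, and a chain that mixes fast cannot have
small flow out of a large set. If the lift is within `1/4` of stationarity after `T` steps, then in
stationarity it leaves the preimage of a set `s` with `π s ≤ 1/2` within `T` steps with conditional
probability at least `1/4`. By a union bound this probability is at most `T` times the normalised
one-step flow, and that flow is the same for `K` and its lift. So `K` has conductance at least `φ =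
1/(4T)` (`measure_le_four_mul_flow_of_isLift`).

The converse is Cheeger's inequality on a general state space, proved by a layer-cake argument.
Together with laziness it contracts the variance by `1 - φ²/8` per step
(`IsHoldOrJump.integral_sq_integral_le`). An `L²` estimate is useless from a point mass, but after
its first jump the chain has law at most `π/π_*`. Hence the distance to `π` after `n + m` steps is
at most the probability `α_x ^ n` of never jumping plus `π_*⁻¹ (1 - φ²/8)^(m/2)`
(`IsHoldOrJump.tvDist_pow_le`).

It remains to keep `α_x` away from `1`. Under (a), continuity in total variation and conductance of
small neighbourhoods give `α_x ≤ 1 - φ`; under (b), the bound on a singleton gives `α_x ≤ 1 - γ`.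
Both imply `α_x ≤ 1 - γφ`. With `L = log (4/π_*)` this yields `γτ ≤ 576 L T²`, which is the claim
because `log (2/√β) ≥ 0.6`. -/

namespace LiftedChains

/-! ### Cheeger's inequality on a general state space -/

section Cheeger

variable {S : Type*} [MeasurableSpace S]

/-- `K` has conductance at least `φ` with respect to `π`: the flow out of every set of measure at
most `1/2` is at least `φ` times its measure. -/
def HasConductance (K : Kernel S S) (π : Measure S) (φ : ℝ) : Prop :=
  ∀ s : Set S, MeasurableSet s → π s ≤ 1 / 2 →
    ENNReal.ofReal φ * π s ≤ ∫⁻ x in s, K x sᶜ ∂π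

/-- Layer-cake argument: apply the conductance bound to each superlevel set of `u` and integrate
over the level. By Tonelli, a transition from `p.1` to `p.2` is counted for the levels in `[u p.2, u
p.1)`, whose total length is the positive part of `u p.1 - u p.2`. -/
theorem HasConductance.lintegral_le {K : Kernel S S} [IsMarkovKernel K] {π : Measure S}
    [IsProbabilityMeasure π] {φ : ℝ} (h : HasConductance K π φ) {u : S → ℝ} (hu : Measurable u)
    (hu0 : ∀ x, 0 ≤ u x) (hmed : ∀ t, 0 < t → π {x | t < u x} ≤ 1 / 2) :
    ENNReal.ofReal φ * ∫⁻ x, ENNReal.ofReal (u x) ∂π ≤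
      ∫⁻ p, ENNReal.ofReal (u p.1 - u p.2) ∂(π ⊗ₘ K) := by
  have hmeas : MeasurableSet {q : ℝ × (S × S) | u q.2.2 ≤ q.1 ∧ q.1 < u q.2.1} :=
    (measurableSet_le (f := fun q : ℝ × (S × S) => u q.2.2) (g := fun q => q.1) (by fun_prop)
      (by fun_prop)).inter (measurableSet_lt (f := fun q : ℝ × (S × S) => q.1)
        (g := fun q => u q.2.1) (by fun_prop) (by fun_prop))
  calc ENNReal.ofReal φ * ∫⁻ x, ENNReal.ofReal (u x) ∂π
      = ∫⁻ t in Ioi (0 : ℝ), ENNReal.ofReal φ * π {x | t < u x} := by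
        rw [lintegral_eq_lintegral_meas_lt π (Eventually.of_forall hu0) hu.aemeasurable,
          lintegral_const_mul' _ _ ENNReal.ofReal_ne_top]
    _ ≤ ∫⁻ t in Ioi (0 : ℝ), (π ⊗ₘ K) {p | u p.2 ≤ t ∧ t < u p.1} := by
        refine setLIntegral_mono' measurableSet_Ioi fun t ht => ?_
        have hs : MeasurableSet {x | t < u x} := measurableSet_lt (by fun_prop) hu
        refine (h _ hs (hmed t ht)).trans ?_
        have hset : {p : S × S | u p.2 ≤ t ∧ t < u p.1} = {x | t < u x} ×ˢ {x | t < u x}ᶜ := by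
          ext p; simp [and_comm]
        rw [hset, Measure.compProd_apply_prod hs hs.compl]
    _ = ∫⁻ t in Ioi (0 : ℝ), ∫⁻ p, {q : ℝ × (S × S) | u q.2.2 ≤ q.1 ∧ q.1 < u q.2.1}.indicator
          1 (t, p) ∂(π ⊗ₘ K) := by
        refine lintegral_congr fun t => ?_
        exact (lintegral_indicator_one (measurable_prodMk_left (x := t) hmeas)).symm
    _ = ∫⁻ p, (∫⁻ t in Ioi (0 : ℝ), {q : ℝ × (S × S) | u q.2.2 ≤ q.1 ∧ q.1 < u q.2.1}.indicator
          1 (t, p)) ∂(π ⊗ₘ K) :=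
        lintegral_lintegral_swap (f := fun (t : ℝ) (p : S × S) =>
          {q : ℝ × (S × S) | u q.2.2 ≤ q.1 ∧ q.1 < u q.2.1}.indicator 1 (t, p))
          (measurable_one.indicator hmeas).aemeasurable
    _ ≤ ∫⁻ p, ENNReal.ofReal (u p.1 - u p.2) ∂(π ⊗ₘ K) := by
        refine lintegral_mono fun p => (setLIntegral_le_lintegral _ _).trans ?_
        rw [← Real.volume_Ico, ← lintegral_indicator_one measurableSet_Ico]
        rfl

theorem integrable_of_abs_le {μ : Measure S} [IsFiniteMeasure μ] {g : S → ℝ} (hg : Measurable g)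
    {C : ℝ} (hC : ∀ x, |g x| ≤ C) : Integrable g μ :=
  Integrable.of_bound hg.aestronglyMeasurable C (Eventually.of_forall hC)

theorem integral_fst_compProd (K : Kernel S S) [IsMarkovKernel K] (π : Measure S)
    [IsProbabilityMeasure π] {g : S → ℝ} (hg : Measurable g) :
    ∫ p, g p.1 ∂(π ⊗ₘ K) = ∫ x, g x ∂π := by
  conv_rhs => rw [← Measure.fst_compProd π K, Measure.fst,
    integral_map (by fun_prop) hg.aestronglyMeasurable]

theorem integral_snd_compProd {K : Kernel S S} [IsMarkovKernel K] {π : Measure S}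
    [IsProbabilityMeasure π] (hK : K.Invariant π) {g : S → ℝ} (hg : Measurable g) :
    ∫ p, g p.2 ∂(π ⊗ₘ K) = ∫ x, g x ∂π := by
  conv_rhs => rw [← hK.def, ← Measure.snd_compProd π K, Measure.snd,
    integral_map (by fun_prop) hg.aestronglyMeasurable]

/-- Cheeger's inequality for a nonnegative function supported on a set of measure at most `1/2`. -/
theorem HasConductance.integral_sq_le {K : Kernel S S} [IsMarkovKernel K] {π : Measure S}
    [IsProbabilityMeasure π] {φ : ℝ} (h : HasConductance K π φ) (hφ : 0 < φ) (hK : K.Invariant π)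
    {u : S → ℝ} (hu : Measurable u) (hu0 : ∀ x, 0 ≤ u x) {C : ℝ} (hC : ∀ x, u x ≤ C)
    (hmed : ∀ t, 0 < t → π {x | t < u x} ≤ 1 / 2) :
    φ ^ 2 / 4 * ∫ x, u x ^ 2 ∂π ≤ ∫ p, (u p.1 - u p.2) ^ 2 ∂(π ⊗ₘ K) := by
  have hmed' : ∀ t, 0 < t → π {x | t < u x ^ 2} ≤ 1 / 2 := fun t ht => by
    have : {x | t < u x ^ 2} = {x | √t < u x} := by
      ext x; exact (Real.sqrt_lt_sqrt_iff ht.le).symm.trans (by rw [Real.sqrt_sq (hu0 x)]; rfl)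
    rw [this]; exact hmed _ (Real.sqrt_pos.2 ht)
  have hsq : ∀ x, u x ^ 2 ≤ C ^ 2 := fun x => pow_le_pow_left₀ (hu0 x) (hC x) 2
  have i1 : Integrable (fun p : S × S => u p.1 ^ 2) (π ⊗ₘ K) :=
    integrable_of_abs_le (C := C ^ 2) (by fun_prop) fun p => by
      rw [abs_of_nonneg (sq_nonneg _)]; exact hsq _
  have i2 : Integrable (fun p : S × S => u p.2 ^ 2) (π ⊗ₘ K) :=
    integrable_of_abs_le (C := C ^ 2) (by fun_prop) fun p => by
      rw [abs_of_nonneg (sq_nonneg _)]; exact hsq _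
  have i3 : Integrable (fun p : S × S => (u p.1 - u p.2) ^ 2) (π ⊗ₘ K) :=
    integrable_of_abs_le (C := C ^ 2) (by fun_prop) fun p => by
      rw [abs_of_nonneg (sq_nonneg _)]
      nlinarith [hu0 p.1, hu0 p.2, hC p.1, hC p.2]
  have i4 : Integrable (fun x : S => u x ^ 2) π :=
    integrable_of_abs_le (C := C ^ 2) (by fun_prop) fun p => by
      rw [abs_of_nonneg (sq_nonneg _)]; exact hsq _
  set D := ∫ p, (u p.1 - u p.2) ^ 2 ∂(π ⊗ₘ K) with hD
  set I := ∫ x, u x ^ 2 ∂π with hI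
  have e1 : ∫ p : S × S, u p.1 ^ 2 ∂(π ⊗ₘ K) = I :=
    integral_fst_compProd K π (g := fun x => u x ^ 2) (by fun_prop)
  have e2 : ∫ p : S × S, u p.2 ^ 2 ∂(π ⊗ₘ K) = I :=
    integral_snd_compProd hK (g := fun x => u x ^ 2) (by fun_prop)
  have i12 : Integrable (fun p : S × S => u p.1 ^ 2 + u p.2 ^ 2) (π ⊗ₘ K) := i1.add i2
  have i5 : Integrable (fun p : S × S => 2 / φ * (u p.1 - u p.2) ^ 2 +
      φ / 4 * (u p.1 ^ 2 + u p.2 ^ 2)) (π ⊗ₘ K) :=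
    (i3.const_mul (2 / φ)).add (i12.const_mul (φ / 4))
  -- The layer-cake bound for `u²`, then weighted AM-GM on `a² - b² = (a - b)(a + b)`. The weight is
  -- chosen so that the term `φ/4 * (I + I)` absorbs only half of `φ * I`.
  have key : φ * I ≤ 2 / φ * D + φ / 4 * (I + I) := by
    have h1 := h.lintegral_le (u := fun x => u x ^ 2) (by fun_prop) (fun x => sq_nonneg _) hmed'
    have h2 : ∫⁻ p : S × S, ENNReal.ofReal (u p.1 ^ 2 - u p.2 ^ 2) ∂(π ⊗ₘ K) ≤
        ∫⁻ p : S × S, ENNReal.ofReal (2 / φ * (u p.1 - u p.2) ^ 2 +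
          φ / 4 * (u p.1 ^ 2 + u p.2 ^ 2)) ∂(π ⊗ₘ K) := by
      refine lintegral_mono fun p => ENNReal.ofReal_le_ofReal ?_
      have h3 : 0 ≤ (4 * (u p.1 - u p.2) - φ * (u p.1 + u p.2)) ^ 2 / (8 * φ) := by positivity
      have h4 : (4 * (u p.1 - u p.2) - φ * (u p.1 + u p.2)) ^ 2 / (8 * φ) =
        2 / φ * (u p.1 - u p.2) ^ 2 - (u p.1 ^ 2 - u p.2 ^ 2) +
          φ / 8 * (u p.1 + u p.2) ^ 2 := by field_simp; ring
      nlinarith [mul_nonneg hφ.le (sq_nonneg (u p.1 - u p.2))]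
    have h5 := h1.trans h2
    rw [← ofReal_integral_eq_lintegral_ofReal i4 (Eventually.of_forall fun x => sq_nonneg _),
      ← ofReal_integral_eq_lintegral_ofReal i5 (Eventually.of_forall fun x => by
        simp only [Pi.zero_apply]; positivity),
      ← ENNReal.ofReal_mul hφ.le] at h5
    rw [integral_add (i3.const_mul _) (i12.const_mul _), integral_const_mul,
      integral_const_mul, integral_add i1 i2, e1, e2] at h5
    have hI0 : 0 ≤ I := integral_nonneg fun _ => sq_nonneg _
    have hD0 : 0 ≤ D := integral_nonneg fun _ => sq_nonneg _
    exact (ENNReal.ofReal_le_ofReal_iff (by positivity)).1 h5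
  have : φ / 2 * I ≤ 2 / φ * D := by linarith
  have h6 := mul_le_mul_of_nonneg_left this (show 0 ≤ φ / 2 by positivity)
  have h7 : φ / 2 * (2 / φ * D) = D := by field_simp
  linarith [show φ / 2 * (φ / 2 * I) = φ ^ 2 / 4 * I by ring]

/-- The infimum of the levels exceeded with probability at most `1/2` is a median. The slack `t > 0`
suffices for superlevel sets and avoids continuity of measure at the infimum. -/
theorem exists_median (π : Measure S) [IsProbabilityMeasure π] {g : S → ℝ} (hg : Measurable g)
    {C : ℝ} (hC : ∀ x, |g x| ≤ C) :
    ∃ m : ℝ, ∀ t, 0 < t → π {x | m + t < g x} ≤ 1 / 2 ∧ π {x | g x < m - t} ≤ 1 / 2 := by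
  set T : Set ℝ := {t | π {x | t < g x} ≤ 1 / 2} with hT
  have hne : T.Nonempty := ⟨C, by
    have : {x | C < g x} = ∅ := by
      ext x; simpa using (le_abs_self _).trans (hC x)
    simp [hT, this]⟩
  have hbdd : BddBelow T := ⟨-C - 1, fun t ht => by
    by_contra! hlt
    have : {x | t < g x} = univ := by
      ext x; simp only [mem_ofPred_eq, mem_univ, iff_true]
      linarith [neg_abs_le (g x), hC x]
    simp only [hT, mem_ofPred_eq, this, measure_univ] at ht
    norm_num at ht⟩
  refine ⟨sInf T, fun t ht => ⟨?_, ?_⟩⟩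
  · obtain ⟨s, hs, hst⟩ := exists_lt_of_csInf_lt hne (lt_add_of_pos_right (sInf T) ht)
    exact (measure_mono fun x hx => hst.trans hx).trans hs
  · have hnot : sInf T - t ∉ T := fun hmem => by linarith [csInf_le hbdd hmem]
    have hlt : 1 / 2 < π {x | sInf T - t < g x} := not_le.1 hnot
    have hsub : {x | g x < sInf T - t} ⊆ {x | sInf T - t < g x}ᶜ := fun x hx => by
      simp only [mem_compl_iff, mem_ofPred_eq, not_lt] at hx ⊢; exact hx.le
    refine (measure_mono hsub).trans ?_
    rw [prob_compl_eq_one_sub (measurableSet_lt (by fun_prop) hg)]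
    refine (tsub_le_tsub_left hlt.le 1).trans ?_
    norm_num

/-- Cheeger's inequality. -/
theorem HasConductance.integral_sq_le_of_integral_eq_zero {K : Kernel S S} [IsMarkovKernel K]
    {π : Measure S} [IsProbabilityMeasure π] {φ : ℝ} (h : HasConductance K π φ) (hφ : 0 < φ)
    (hK : K.Invariant π) {g : S → ℝ} (hg : Measurable g) {C : ℝ} (hC : ∀ x, |g x| ≤ C)
    (hmean : ∫ x, g x ∂π = 0) :
    φ ^ 2 / 4 * ∫ x, g x ^ 2 ∂π ≤ ∫ p, (g p.1 - g p.2) ^ 2 ∂(π ⊗ₘ K) := by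
  obtain ⟨m, hm⟩ := exists_median π hg hC
  -- The two parts of `g - m` around the median are each supported on a set of measure at most
  -- `1/2`, up to the slack.
  set u : S → ℝ := fun x => max (g x - m) 0 with hu
  set v : S → ℝ := fun x => max (m - g x) 0 with hv
  have hC0 : 0 ≤ C := by
    obtain ⟨x⟩ := nonempty_of_isProbabilityMeasure π
    exact (abs_nonneg _).trans (hC x)
  have hgC := fun x => abs_le.1 (hC x)
  have hmu : Measurable u := by fun_prop
  have hmv : Measurable v := by fun_prop
  have u0 : ∀ x, 0 ≤ u x := fun x => le_max_right _ _
  have v0 : ∀ x, 0 ≤ v x := fun x => le_max_right _ _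
  have uC : ∀ x, u x ≤ C + |m| := fun x => max_le (by linarith [hgC x, neg_abs_le m]) (by positivity)
  have vC : ∀ x, v x ≤ C + |m| := fun x => max_le (by linarith [hgC x, le_abs_self m]) (by positivity)
  have key1 := h.integral_sq_le hφ hK hmu u0 uC fun t ht => by
    convert (hm t ht).1 using 3
    simp only [hu, lt_max_iff, ht.not_gt, or_false]
    ext x; constructor <;> intro <;> linarith
  have key2 := h.integral_sq_le hφ hK hmv v0 vC fun t ht => by
    convert (hm t ht).2 using 3
    simp only [hv, lt_max_iff, ht.not_gt, or_false]
    ext x; constructor <;> intro <;> linarith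
  have sqb : ∀ {a : ℝ}, 0 ≤ a → a ≤ C + |m| → |a ^ 2| ≤ (C + |m|) ^ 2 := fun h1 h2 => by
    rw [abs_of_nonneg (sq_nonneg _)]; gcongr
  have sqd : ∀ {a b : ℝ}, 0 ≤ a → a ≤ C + |m| → 0 ≤ b → b ≤ C + |m| →
      |(a - b) ^ 2| ≤ (C + |m|) ^ 2 := fun h1 h2 h3 h4 => by
    rw [abs_of_nonneg (sq_nonneg _), sq_le_sq, abs_of_nonneg (show 0 ≤ C + |m| by positivity),
      abs_le]
    constructor <;> linarith
  have iu : Integrable (fun x => u x ^ 2) π :=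
    integrable_of_abs_le (by fun_prop) fun x => sqb (u0 x) (uC x)
  have iv : Integrable (fun x => v x ^ 2) π :=
    integrable_of_abs_le (by fun_prop) fun x => sqb (v0 x) (vC x)
  have ig : Integrable g π := integrable_of_abs_le hg hC
  have ig2 : Integrable (fun x => g x ^ 2) π :=
    integrable_of_abs_le (C := C ^ 2) (by fun_prop) fun x => by
      rw [abs_of_nonneg (sq_nonneg _), ← sq_abs]; gcongr; exact hC x
  have idu : Integrable (fun p : S × S => (u p.1 - u p.2) ^ 2) (π ⊗ₘ K) :=
    integrable_of_abs_le (by fun_prop) fun p => sqd (u0 _) (uC _) (u0 _) (uC _)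
  have idv : Integrable (fun p : S × S => (v p.1 - v p.2) ^ 2) (π ⊗ₘ K) :=
    integrable_of_abs_le (by fun_prop) fun p => sqd (v0 _) (vC _) (v0 _) (vC _)
  have idg : Integrable (fun p : S × S => (g p.1 - g p.2) ^ 2) (π ⊗ₘ K) :=
    integrable_of_abs_le (C := (2 * C) ^ 2) (by fun_prop) fun p => by
      rw [abs_of_nonneg (sq_nonneg _), sq_le_sq, abs_of_nonneg (show 0 ≤ 2 * C by positivity),
        abs_le]
      constructor <;> linarith [hgC p.1, hgC p.2]
  -- Since `g` has mean zero, replacing it by `g - m` can only increase the second moment, and `u² +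
  -- v² = (g - m)²`.
  have hsum : ∫ x, g x ^ 2 ∂π ≤ ∫ x, u x ^ 2 ∂π + ∫ x, v x ^ 2 ∂π := by
    have h1 : ∫ x, (g x ^ 2 - 2 * m * g x) ∂π ≤ ∫ x, (u x ^ 2 + v x ^ 2) ∂π := by
      refine integral_mono (ig2.sub (ig.const_mul _)) (iu.add iv) fun x => ?_
      simp only [hu, hv]
      rcases le_total (g x) m with hx | hx
      · rw [max_eq_right (by linarith), max_eq_left (by linarith)]; nlinarith [sq_nonneg m]
      · rw [max_eq_left (by linarith), max_eq_right (by linarith)]; nlinarith [sq_nonneg m]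
    rwa [integral_sub ig2 (ig.const_mul _), integral_const_mul, hmean, mul_zero, sub_zero,
      integral_add iu iv] at h1
  -- As `u * v = 0`, the cross term in the square of `(u p.1 - u p.2) - (v p.1 - v p.2)` equals `2
  -- (u p.1 * v p.2 + u p.2 * v p.1)`, which is nonnegative.
  have hdir : ∫ p, (u p.1 - u p.2) ^ 2 ∂(π ⊗ₘ K) + ∫ p, (v p.1 - v p.2) ^ 2 ∂(π ⊗ₘ K) ≤
      ∫ p, (g p.1 - g p.2) ^ 2 ∂(π ⊗ₘ K) := by
    rw [← integral_add idu idv]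
    refine integral_mono (idu.add idv) idg fun p => ?_
    simp only [hu, hv]
    rcases le_total (g p.1) m with hx | hx <;> rcases le_total (g p.2) m with hy | hy
    · rw [max_eq_right (by linarith), max_eq_right (by linarith), max_eq_left (by linarith),
        max_eq_left (by linarith)]; nlinarith
    · rw [max_eq_right (by linarith), max_eq_left (by linarith), max_eq_left (by linarith),
        max_eq_right (by linarith)]; nlinarith
    · rw [max_eq_left (by linarith), max_eq_right (by linarith), max_eq_right (by linarith),
        max_eq_left (by linarith)]; nlinarith
    · rw [max_eq_left (by linarith), max_eq_left (by linarith), max_eq_right (by linarith),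
        max_eq_right (by linarith)]; nlinarith
  have := mul_le_mul_of_nonneg_left hsum (show 0 ≤ φ ^ 2 / 4 by positivity)
  linarith

end Cheeger

/-! ### From conductance to mixing for hold-or-jump kernels -/

section Mixing

variable {S : Type*} [MeasurableSpace S]

/-- `K x` holds at `x` with probability `a x ∈ [1/2, 1]` and otherwise jumps according to a
probability measure bounded by `C • π`. -/
structure IsHoldOrJump (K : Kernel S S) (π : Measure S) (a : S → ℝ) (C : ℝ≥0∞) : Prop where
  half_le : ∀ x, 1 / 2 ≤ a x
  le_one : ∀ x, a x ≤ 1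
  exists_jump : ∀ x, ∃ μ : Measure S, IsProbabilityMeasure μ ∧ μ ≤ C • π ∧
    K x = ENNReal.ofReal (a x) • Measure.dirac x + ENNReal.ofReal (1 - a x) • μ

theorem isMarkovKernel_pow (K : Kernel S S) [IsMarkovKernel K] (n : ℕ) :
    IsMarkovKernel (K ^ n) := by
  induction n with
  | zero => rw [pow_zero]; exact inferInstanceAs (IsMarkovKernel Kernel.id)
  | succ n ih => rw [pow_succ]; exact inferInstanceAs (IsMarkovKernel ((K ^ n) ∘ₖ K))

theorem invariant_pow {K : Kernel S S} [IsMarkovKernel K] {π : Measure S} (hK : K.Invariant π)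
    (n : ℕ) : (K ^ n).Invariant π := by
  induction n with
  | zero => rw [pow_zero]; exact Measure.bind_dirac
  | succ n ih => rw [pow_succ]; exact ih.comp hK

/-- Pointwise substitute for the spectral fact that lazy kernels have no negative spectrum. With
`m`, `V` the first two moments of `g` under the jump law, the variance of `g` under `K x` is
`a(1-a)(g x - m)² + (1-a)(V - m²)`, while the subtracted term is `(1-a)/2` times `(g x - m)² + (V -
m²)`; compare using `a ≥ 1/2`. -/
theorem IsHoldOrJump.sq_integral_add_le {K : Kernel S S} {π : Measure S} {a : S → ℝ} {C : ℝ≥0∞}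
    (h : IsHoldOrJump K π a C) {g : S → ℝ} (hg : Measurable g) {M : ℝ} (hM : ∀ x, |g x| ≤ M)
    (x : S) :
    (∫ y, g y ∂(K x)) ^ 2 + 1 / 2 * ∫ y, (g x - g y) ^ 2 ∂(K x) ≤ ∫ y, g y ^ 2 ∂(K x) := by
  obtain ⟨μ, hμ, -, hx⟩ := h.exists_jump x
  have ha := h.half_le x
  have ha1 := h.le_one x
  have hsplit : ∀ f : S → ℝ, Measurable f → Integrable f μ →
      ∫ y, f y ∂(K x) = a x * f x + (1 - a x) * ∫ y, f y ∂μ := fun f hf hfi => by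
    rw [hx, integral_add_measure, integral_smul_measure, integral_smul_measure,
      integral_dirac' _ _ hf.stronglyMeasurable, ENNReal.toReal_ofReal (by linarith),
      ENNReal.toReal_ofReal (by linarith), smul_eq_mul, smul_eq_mul]
    · exact ((integrable_dirac' hf.stronglyMeasurable (by simp))).smul_measure
        ENNReal.ofReal_ne_top
    · exact hfi.smul_measure ENNReal.ofReal_ne_top
  have ig : Integrable g μ := integrable_of_abs_le hg hM
  have ig2 : Integrable (fun y => g y ^ 2) μ :=
    integrable_of_abs_le (C := M ^ 2) (by fun_prop) fun x => by
      rw [abs_of_nonneg (sq_nonneg _), ← sq_abs]; gcongr; exact hM x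
  have hexp : ∀ c : ℝ, ∫ y, (c - g y) ^ 2 ∂μ = c ^ 2 - 2 * c * ∫ y, g y ∂μ + ∫ y, g y ^ 2 ∂μ := by
    intro c
    have : ∀ y, (c - g y) ^ 2 = c ^ 2 - 2 * c * g y + g y ^ 2 := fun y => by ring
    simp_rw [this]
    rw [integral_add (by fun_prop) ig2, integral_sub (by fun_prop) (by fun_prop),
      integral_const_mul]
    simp
  have id2 : Integrable (fun y => (g x - g y) ^ 2) μ := by
    have : (fun y => (g x - g y) ^ 2) = fun y => g x ^ 2 - 2 * g x * g y + g y ^ 2 := by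
      ext y; ring
    rw [this]; fun_prop
  rw [hsplit g hg ig, hsplit _ (by fun_prop) ig2, hsplit _ (by fun_prop) id2, hexp]
  have hV := hexp (∫ y, g y ∂μ)
  have hV0 : 0 ≤ ∫ y, ((∫ y, g y ∂μ) - g y) ^ 2 ∂μ := integral_nonneg fun _ => sq_nonneg _
  rw [hV] at hV0
  generalize ∫ y, g y ∂μ = m at *
  generalize ∫ y, g y ^ 2 ∂μ = V at *
  have hb : 0 ≤ (1 - a x) * (a x - 1 / 2) := mul_nonneg (by linarith) (by linarith)
  nlinarith [mul_nonneg hb (sq_nonneg (g x - m)),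
    mul_nonneg (show 0 ≤ 1 - a x by linarith) (show 0 ≤ V - m ^ 2 by nlinarith)]

/-- A lazy kernel with conductance `φ` contracts the variance. -/
theorem IsHoldOrJump.integral_sq_integral_le {K : Kernel S S} [IsMarkovKernel K] {π : Measure S}
    [IsProbabilityMeasure π] {a : S → ℝ} {C : ℝ≥0∞} (h : IsHoldOrJump K π a C)
    {φ : ℝ} (hcond : HasConductance K π φ) (hφ : 0 < φ) (hK : K.Invariant π)
    {g : S → ℝ} (hg : Measurable g) {M : ℝ} (hM : ∀ x, |g x| ≤ M) (hmean : ∫ x, g x ∂π = 0) :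
    ∫ x, (∫ y, g y ∂(K x)) ^ 2 ∂π ≤ (1 - φ ^ 2 / 8) * ∫ x, g x ^ 2 ∂π := by
  have hch := hcond.integral_sq_le_of_integral_eq_zero hφ hK hg hM hmean
  have hM0 : 0 ≤ M := by
    obtain ⟨x⟩ := nonempty_of_isProbabilityMeasure π
    exact (abs_nonneg _).trans (hM x)
  have id2 : Integrable (fun p : S × S => (g p.1 - g p.2) ^ 2) (π ⊗ₘ K) :=
    integrable_of_abs_le (C := (2 * M) ^ 2) (by fun_prop) fun p => by
      rw [abs_of_nonneg (sq_nonneg _), sq_le_sq, abs_of_nonneg (show 0 ≤ 2 * M by positivity)]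
      exact (abs_sub _ _).trans (by linarith [hM p.1, hM p.2])
  have ig2 : Integrable (fun p : S × S => g p.2 ^ 2) (π ⊗ₘ K) :=
    integrable_of_abs_le (C := M ^ 2) (by fun_prop) fun x => by
      rw [abs_of_nonneg (sq_nonneg _), ← sq_abs]; gcongr; exact hM _
  have hKg : Measurable fun x => ∫ y, g y ∂(K x) :=
    (hg.stronglyMeasurable.integral_kernel (κ := K)).measurable
  have hKgM : ∀ x, |∫ y, g y ∂(K x)| ≤ M := fun x => by
    have := norm_integral_le_of_norm_le_const (μ := K x) (f := g) (Eventually.of_forall hM)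
    simpa using this
  have iKg : Integrable (fun x => (∫ y, g y ∂(K x)) ^ 2) π :=
    integrable_of_abs_le (C := M ^ 2) (by fun_prop) fun x => by
      rw [abs_of_nonneg (sq_nonneg _), ← sq_abs]; gcongr; exact hKgM x
  have e1 := Measure.integral_compProd id2
  have e2 := Measure.integral_compProd ig2
  rw [integral_snd_compProd hK (g := fun x => g x ^ 2) (by fun_prop)] at e2
  have id3 : Integrable (fun x => ∫ y, (g x - g y) ^ 2 ∂(K x)) π :=
    Integrable.integral_compProd id2
  have ig3 : Integrable (fun x => ∫ y, g y ^ 2 ∂(K x)) π := Integrable.integral_compProd ig2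
  have hle : ∫ x, ((∫ y, g y ∂(K x)) ^ 2 + 1 / 2 * ∫ y, (g x - g y) ^ 2 ∂(K x)) ∂π ≤
      ∫ x, ∫ y, g y ^ 2 ∂(K x) ∂π :=
    integral_mono (iKg.add (id3.const_mul _)) ig3
      fun x => h.sq_integral_add_le hg hM x
  rw [integral_add iKg (id3.const_mul _), integral_const_mul, ← e1, ← e2] at hle
  linarith

/-- The function `x ↦ K^n(x, s) - π(s)` has mean zero by invariance, and applying `K` to it raises
`n` by one, so the variance contraction iterates. -/
theorem integral_sq_pow_sub_le {K : Kernel S S} [IsMarkovKernel K] {π : Measure S}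
    [IsProbabilityMeasure π] {a : S → ℝ} {C : ℝ≥0∞} (h : IsHoldOrJump K π a C)
    {φ : ℝ} (hcond : HasConductance K π φ) (hφ : 0 < φ) (hφ1 : φ ≤ 1) (hK : K.Invariant π)
    {s : Set S} (hs : MeasurableSet s) (n : ℕ) :
    ∫ x, (((K ^ n) x).real s - π.real s) ^ 2 ∂π ≤ (1 - φ ^ 2 / 8) ^ n := by
  have := isMarkovKernel_pow K
  have hmeas : ∀ n, Measurable fun x => ((K ^ n) x).real s - π.real s := fun n =>
    ((K ^ n).measurable_coe hs).ennreal_toReal.sub_const _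
  have hbd : ∀ n x, |((K ^ n) x).real s - π.real s| ≤ 1 := fun n x =>
    abs_sub_le_of_nonneg_of_le measureReal_nonneg measureReal_le_one measureReal_nonneg
      measureReal_le_one
  induction n with
  | zero =>
    have := norm_integral_le_of_norm_le_const (μ := π) (C := 1)
      (f := fun x => (((K ^ 0) x).real s - π.real s) ^ 2) (Eventually.of_forall fun x => by
        rw [Real.norm_eq_abs, abs_pow]; exact pow_le_one₀ (abs_nonneg _) (hbd 0 x))
    simpa using (le_abs_self _).trans this
  | succ n ih =>
    have hmean : ∫ x, (((K ^ n) x).real s - π.real s) ∂π = 0 := by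
      have h1 : ∫ x, ((K ^ n) x).real s ∂π = π.real s := by
        simp only [Measure.real]
        rw [integral_toReal ((K ^ n).measurable_coe hs).aemeasurable (by simp),
          ← Measure.bind_apply hs (K ^ n).aemeasurable, (invariant_pow hK n).def]
      rw [integral_sub _ (by fun_prop), h1]
      · simp
      · exact integrable_of_abs_le (C := 1) ((K ^ n).measurable_coe hs).ennreal_toReal fun x => by
          rw [abs_of_nonneg measureReal_nonneg]; exact measureReal_le_one
    have hstep : ∀ x, ∫ y, (((K ^ n) y).real s - π.real s) ∂(K x) =
        ((K ^ (n + 1)) x).real s - π.real s := fun x => by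
      rw [integral_sub _ (by fun_prop)]
      · simp only [Measure.real]
        rw [integral_toReal ((K ^ n).measurable_coe hs).aemeasurable (by simp), add_comm n 1,
          Kernel.pow_add_apply_eq_lintegral _ _ _ _ hs]
        simp
      · exact integrable_of_abs_le (C := 1) ((K ^ n).measurable_coe hs).ennreal_toReal fun x => by
          rw [abs_of_nonneg measureReal_nonneg]; exact measureReal_le_one
    have hc := h.integral_sq_integral_le hcond hφ hK (hmeas n) (hbd n) hmean
    simp only [hstep] at hc
    refine hc.trans ?_
    rw [pow_succ' (1 - φ ^ 2 / 8)]
    exact mul_le_mul_of_nonneg_left ih (by nlinarith)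

/-- The weight `a x ^ n` is the probability of no jump so far. The first jump leads to a law below
`C • π`, and invariance preserves this domination at all later steps. -/
theorem IsHoldOrJump.pow_apply_le {K : Kernel S S} [IsMarkovKernel K] {π : Measure S}
    {a : S → ℝ} {C : ℝ≥0∞} (h : IsHoldOrJump K π a C) (hK : K.Invariant π) (x : S) (n : ℕ) :
    (K ^ n) x ≤ ENNReal.ofReal (a x ^ n) • Measure.dirac x +
      (ENNReal.ofReal (1 - a x ^ n) * C) • π := by
  have ha0 : 0 ≤ a x := by linarith [h.half_le x]
  have han : ∀ n, a x ^ n ≤ 1 := fun n => pow_le_one₀ ha0 (h.le_one x)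
  induction n with
  | zero =>
    simp only [pow_zero, ENNReal.ofReal_one, one_smul, sub_self, ENNReal.ofReal_zero, zero_mul,
      zero_smul, add_zero]
    exact le_rfl
  | succ n ih =>
    obtain ⟨μ, hμ, hμC, hx⟩ := h.exists_jump x
    refine Measure.le_iff.2 fun s hs => ?_
    rw [Kernel.pow_succ_apply_eq_lintegral _ _ _ hs]
    have hμs : μ s ≤ C * π s := hμC s
    calc ∫⁻ b, K b s ∂((K ^ n) x)
        ≤ ∫⁻ b, K b s ∂(ENNReal.ofReal (a x ^ n) • Measure.dirac x +
            (ENNReal.ofReal (1 - a x ^ n) * C) • π) := lintegral_mono' ih le_rfl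
      _ = ENNReal.ofReal (a x ^ n) * K x s + ENNReal.ofReal (1 - a x ^ n) * C * π s := by
        rw [lintegral_add_measure, lintegral_smul_measure, lintegral_smul_measure,
          lintegral_dirac' _ (K.measurable_coe hs), ← Measure.bind_apply hs K.aemeasurable, hK.def]
        rfl
      _ ≤ ENNReal.ofReal (a x ^ n) * (ENNReal.ofReal (a x) * Measure.dirac x s +
          ENNReal.ofReal (1 - a x) * (C * π s)) + ENNReal.ofReal (1 - a x ^ n) * C * π s := by
        rw [hx]
        simp only [Measure.coe_add, Measure.coe_smul, Pi.add_apply, Pi.smul_apply, smul_eq_mul]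
        gcongr
      _ = ENNReal.ofReal (a x ^ (n + 1)) * Measure.dirac x s +
          ENNReal.ofReal (1 - a x ^ (n + 1)) * C * π s := by
        have e1 : ENNReal.ofReal (a x ^ (n + 1)) =
            ENNReal.ofReal (a x ^ n) * ENNReal.ofReal (a x) := by
          rw [pow_succ, ENNReal.ofReal_mul (pow_nonneg ha0 n)]
        have e2 : ENNReal.ofReal (1 - a x ^ (n + 1)) =
            ENNReal.ofReal (a x ^ n) * ENNReal.ofReal (1 - a x) +
              ENNReal.ofReal (1 - a x ^ n) := by
          rw [← ENNReal.ofReal_mul (pow_nonneg ha0 n), ← ENNReal.ofReal_add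
            (mul_nonneg (pow_nonneg ha0 n) (by linarith [h.le_one x])) (by linarith [han n])]
          congr 1; ring
        rw [e1, e2]; ring
      _ = _ := rfl

/-- The first `n` steps produce a warm start, the last `m` steps use `L²` decay. On the surviving
point mass the error is bounded trivially by `1`; on the part dominated by `C • π` the `L¹` norm is
bounded by the `L²` norm. -/
theorem IsHoldOrJump.tvDist_pow_le {K : Kernel S S} [IsMarkovKernel K] {π : Measure S}
    [IsProbabilityMeasure π] {a : S → ℝ} {C : ℝ≥0∞} (h : IsHoldOrJump K π a C)
    {φ : ℝ} (hcond : HasConductance K π φ) (hφ : 0 < φ) (hφ1 : φ ≤ 1) (hK : K.Invariant π)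
    (x : S) (n m : ℕ) :
    tvDist ((K ^ (n + m)) x) π ≤
      ENNReal.ofReal (a x ^ n) + C * ENNReal.ofReal (√((1 - φ ^ 2 / 8) ^ m)) := by
  have := isMarkovKernel_pow K
  have ha0 : 0 ≤ a x := by linarith [h.half_le x]
  refine iSup₂_le fun s hs => tsub_le_iff_left.2 ?_
  set f : S → ℝ := fun y => ((K ^ m) y).real s - π.real s with hf
  have hfm : Measurable f := ((K ^ m).measurable_coe hs).ennreal_toReal.sub_const _
  have hbd : ∀ y, |f y| ≤ 1 := fun y =>
    abs_sub_le_of_nonneg_of_le measureReal_nonneg measureReal_le_one measureReal_nonneg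
      measureReal_le_one
  have hpt : ∀ y, (K ^ m) y s ≤ π s + ENNReal.ofReal |f y| := fun y => by
    rw [← ofReal_measureReal (μ := (K ^ m) y), ← ofReal_measureReal (μ := π),
      ← ENNReal.ofReal_add measureReal_nonneg (abs_nonneg _)]
    exact ENNReal.ofReal_le_ofReal (by linarith [le_abs_self (f y)])
  have hL1 : ∫⁻ y, ENNReal.ofReal |f y| ∂π ≤ ENNReal.ofReal (√((1 - φ ^ 2 / 8) ^ m)) := by
    have i1 : Integrable (fun y => |f y|) π :=
      integrable_of_abs_le hfm.abs fun y => by rw [abs_abs]; exact hbd y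
    have i2 : Integrable (fun y => f y ^ 2) π :=
      integrable_of_abs_le (C := 1) (by fun_prop) fun y => by
        rw [abs_pow]; exact pow_le_one₀ (abs_nonneg _) (hbd y)
    rw [← ofReal_integral_eq_lintegral_ofReal i1 (Eventually.of_forall fun y => abs_nonneg _)]
    refine ENNReal.ofReal_le_ofReal (Real.le_sqrt_of_sq_le (le_trans ?_
      (integral_sq_pow_sub_le h hcond hφ hφ1 hK hs m)))
    set c := ∫ y, |f y| ∂π with hc
    -- Nonnegativity of the variance of `|f|` gives `‖f‖₁² ≤ ‖f‖₂²`.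
    have : 0 ≤ ∫ y, (f y ^ 2 - 2 * c * |f y| + c ^ 2) ∂π := integral_nonneg fun y => by
      show 0 ≤ f y ^ 2 - 2 * c * |f y| + c ^ 2
      nlinarith [sq_nonneg (|f y| - c), sq_abs (f y)]
    rw [integral_add (by fun_prop) (by fun_prop), integral_sub i2 (by fun_prop),
      integral_const_mul, ← hc] at this
    simp at this
    linarith
  calc (K ^ (n + m)) x s
      = ∫⁻ y, (K ^ m) y s ∂((K ^ n) x) := Kernel.pow_add_apply_eq_lintegral _ _ _ _ hs
    _ ≤ ∫⁻ y, (π s + ENNReal.ofReal |f y|) ∂((K ^ n) x) := lintegral_mono hpt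
    _ = π s + ∫⁻ y, ENNReal.ofReal |f y| ∂((K ^ n) x) := by
      rw [lintegral_add_left measurable_const]; simp
    _ ≤ π s + ∫⁻ y, ENNReal.ofReal |f y| ∂(ENNReal.ofReal (a x ^ n) • Measure.dirac x +
        (ENNReal.ofReal (1 - a x ^ n) * C) • π) := by
      gcongr; exact h.pow_apply_le hK x n
    _ = π s + (ENNReal.ofReal (a x ^ n) * ENNReal.ofReal |f x| +
        ENNReal.ofReal (1 - a x ^ n) * C * ∫⁻ y, ENNReal.ofReal |f y| ∂π) := by
      rw [lintegral_add_measure, lintegral_smul_measure, lintegral_smul_measure,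
        lintegral_dirac' _ hfm.abs.ennreal_ofReal]
      rfl
    _ ≤ π s + (ENNReal.ofReal (a x ^ n) * 1 +
        1 * C * ENNReal.ofReal (√((1 - φ ^ 2 / 8) ^ m))) := by
      gcongr
      · exact ENNReal.ofReal_le_one.2 (hbd x)
      · exact ENNReal.ofReal_le_one.2 (by linarith [pow_nonneg ha0 n])
    _ = _ := by rw [mul_one, one_mul]

end Mixing

/-! ### Flow out of a set, and its transfer along a lift -/

section Lift

variable {S S' : Type*} [MeasurableSpace S] [MeasurableSpace S']

/-- In stationarity, the probability of having left `B` after `n` steps is at most `n` times the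
flow out of `B`. -/
theorem lintegral_pow_compl_le {K : Kernel S S} [IsMarkovKernel K] {π : Measure S}
    (hK : K.Invariant π) {B : Set S} (hB : MeasurableSet B) (n : ℕ) :
    ∫⁻ x in B, (K ^ n) x Bᶜ ∂π ≤ n * ∫⁻ x in B, K x Bᶜ ∂π := by
  have := isMarkovKernel_pow K
  induction n with
  | zero =>
    refine le_of_eq ?_
    rw [Nat.cast_zero, zero_mul, ← lintegral_zero (μ := π.restrict B)]
    refine setLIntegral_congr_fun hB fun x hx => ?_
    rw [pow_zero]
    show Measure.dirac x Bᶜ = 0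
    rw [Measure.dirac_apply' _ hB.compl]
    simp [hx]
  | succ n ih =>
    -- A chain outside `B` at time `n + 1` was already outside at time `n`, or crosses from `B` to
    -- `Bᶜ` in the last step.
    have hstep : ∀ x, (K ^ (n + 1)) x Bᶜ ≤
        (K ^ n) x Bᶜ + ∫⁻ y, B.indicator (fun y => K y Bᶜ) y ∂((K ^ n) x) := fun x => by
      rw [Kernel.pow_succ_apply_eq_lintegral _ _ _ hB.compl, ← lintegral_add_compl _ hB, add_comm,
        lintegral_indicator hB]
      gcongr
      calc ∫⁻ y in Bᶜ, K y Bᶜ ∂((K ^ n) x) ≤ ∫⁻ y in Bᶜ, 1 ∂((K ^ n) x) :=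
            lintegral_mono fun y => prob_le_one
        _ = (K ^ n) x Bᶜ := by simp
    have hind : Measurable (B.indicator fun y => K y Bᶜ) :=
      (K.measurable_coe hB.compl).indicator hB
    calc ∫⁻ x in B, (K ^ (n + 1)) x Bᶜ ∂π
        ≤ ∫⁻ x in B, ((K ^ n) x Bᶜ + ∫⁻ y, B.indicator (fun y => K y Bᶜ) y ∂((K ^ n) x)) ∂π :=
          lintegral_mono hstep
      _ = ∫⁻ x in B, (K ^ n) x Bᶜ ∂π +
          ∫⁻ x in B, ∫⁻ y, B.indicator (fun y => K y Bᶜ) y ∂((K ^ n) x) ∂π :=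
          lintegral_add_left ((K ^ n).measurable_coe hB.compl) _
      _ ≤ n * ∫⁻ x in B, K x Bᶜ ∂π +
          ∫⁻ x, ∫⁻ y, B.indicator (fun y => K y Bᶜ) y ∂((K ^ n) x) ∂π :=
          add_le_add ih (setLIntegral_le_lintegral _ _)
      _ = n * ∫⁻ x in B, K x Bᶜ ∂π + ∫⁻ x in B, K x Bᶜ ∂π := by
          rw [← Measure.lintegral_bind (K ^ n).aemeasurable hind.aemeasurable,
            (invariant_pow hK n).def, lintegral_indicator hB]
      _ = _ := by push_cast; ring

/-- A set of measure at most `1/2` is left within `T` steps with probability at least `1/4` if the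
chain is within `1/4` of stationarity after `T` steps. -/
theorem measure_le_four_mul_flow {K : Kernel S S} [IsMarkovKernel K] {π : Measure S}
    (hK : K.Invariant π) {T : ℕ} (hT : (⨆ x, tvDist ((K ^ T) x) π) < 1 / 4)
    {B : Set S} (hB : MeasurableSet B) (hB2 : π B ≤ 1 / 2) :
    π B ≤ 4 * (T * ∫⁻ x in B, K x Bᶜ ∂π) := by
  have := isMarkovKernel_pow K
  -- Here `K^T(x, B) ≤ π(B) + 1/4 ≤ 3/4`.
  have hx : ∀ x, 1 / 4 ≤ (K ^ T) x Bᶜ := fun x => by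
    have h1 : (K ^ T) x B - π B ≤ 1 / 4 :=
      (le_iSup₂ (f := fun (A : Set S) (_ : MeasurableSet A) => (K ^ T) x A - π A) B hB).trans
        ((le_iSup (fun x => tvDist ((K ^ T) x) π) x).trans hT.le)
    have h2 : (K ^ T) x B ≤ 1 / 2 + 1 / 4 := (tsub_le_iff_left.1 h1).trans (by gcongr)
    rw [prob_compl_eq_one_sub hB]
    refine le_trans (le_of_eq ?_) (tsub_le_tsub_left h2 1)
    have h3 : (1 : ℝ≥0∞) = 1 / 4 + (1 / 2 + 1 / 4) := by
      rw [← ENNReal.toReal_eq_toReal_iff' (by simp) (by simp [ENNReal.add_eq_top])]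
      rw [ENNReal.toReal_add (by simp) (by simp [ENNReal.add_eq_top]),
        ENNReal.toReal_add (by simp) (by simp)]
      norm_num
    exact ENNReal.eq_sub_of_add_eq (by simp [ENNReal.add_eq_top]) h3.symm
  calc π B = 4 * (1 / 4 * π B) := by
        rw [← mul_assoc, one_div, ENNReal.mul_inv_cancel (by simp) (by simp), one_mul]
    _ = 4 * ∫⁻ _ in B, 1 / 4 ∂π := by simp
    _ ≤ 4 * ∫⁻ x in B, (K ^ T) x Bᶜ ∂π := by gcongr with x; exact hx x
    _ ≤ _ := by gcongr; exact lintegral_pow_compl_le hK hB T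

/-- The lift property, evaluated on `sᶜ`, says that the flows out of `f ⁻¹' s` and out of `s` agree,
so the bound for the lifted chain descends. -/
theorem measure_le_four_mul_flow_of_isLift {K : Kernel S S} [IsMarkovKernel K] {π : Measure S}
    [IsProbabilityMeasure π] (hK : K.Invariant π) {K' : Kernel S' S'} [IsMarkovKernel K']
    {π' : Measure S'} [IsProbabilityMeasure π'] (hK' : K'.Invariant π') (hlift : IsLift K π K' π')
    {T : ℕ} (hT : (⨆ x, tvDist ((K' ^ T) x) π') < 1 / 4)
    {s : Set S} (hs : MeasurableSet s) (hs2 : π s ≤ 1 / 2) :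
    π s ≤ 4 * (T * ∫⁻ x in s, K x sᶜ ∂π) := by
  obtain ⟨f, hf, hlift⟩ := hlift
  rcases eq_or_ne (π s) 0 with h0 | h0
  · simp [h0]
  -- Conditioning on the whole space is vacuous, so the lift property and both invariances give that
  -- `f` pushes `π'` to `π`.
  have hmap : ∀ t, MeasurableSet t → π' (f ⁻¹' t) = π t := fun t ht => by
    have := hlift univ .univ (by simp)
    rw [preimage_univ, cond_univ, cond_univ, hK'.def, hK.def] at this
    rw [← this, Measure.map_apply hf ht]
  have hB : MeasurableSet (f ⁻¹' s) := hf hs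
  have hflow := congrArg (fun μ => μ sᶜ) (hlift s hs (pos_iff_ne_zero.2 h0))
  rw [Measure.map_apply hf hs.compl, Measure.bind_apply (hf hs.compl) K'.aemeasurable,
    Measure.bind_apply hs.compl K.aemeasurable, ProbabilityTheory.cond, ProbabilityTheory.cond,
    lintegral_smul_measure, lintegral_smul_measure, hmap s hs, preimage_compl] at hflow
  have hflow' := (ENNReal.mul_right_inj (ENNReal.inv_ne_zero.2 (measure_ne_top π s))
    (ENNReal.inv_ne_top.2 h0)).1 hflow
  rw [← hflow', ← hmap s hs]
  exact measure_le_four_mul_flow hK' hT hB (by rwa [hmap s hs])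

end Lift

/-! ### Consequences of the mixture representation and bounds on the holding probabilities -/

section Representation

variable {d : ℕ} {Ω : Set (Fin d → ℝ)} {K : Kernel Ω Ω} {π : Measure Ω} {α : (Fin d → ℝ) → ℝ}
  {𝒰 : (Fin d → ℝ) → Set (Set Ω)} {w : (Fin d → ℝ) → Set Ω → ℝ≥0∞}

/-- Each `π|_U` of positive weight is below `π / π_*`, and so is any mixture of them. Weight zero is
treated apart, since such a `U` may be `π`-null and then conditioning gives the zero measure. -/
theorem IsMixture.isHoldOrJump [IsProbabilityMeasure π] (h : IsMixture K π α 𝒰 w)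
    (hstar : 0 < piStar π 𝒰 w) :
    IsHoldOrJump K π (fun x : Ω => α x) (piStar π 𝒰 w)⁻¹ where
  half_le x := (h.holding_mem x).1
  le_one x := (h.holding_mem x).2.le
  exists_jump x := by
    have hU : ∀ U : 𝒰 x, w x U ≠ 0 → piStar π 𝒰 w ≤ π U := fun U hw =>
      iInf₂_le (U : Set Ω) ⟨x, U.2, pos_iff_ne_zero.2 hw⟩
    refine ⟨Measure.sum fun U : 𝒰 x => w x U • ProbabilityTheory.cond π (U : Set Ω), ⟨?_⟩, ?_,
      h.kernel_eq x⟩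
    · rw [Measure.sum_apply _ .univ, ← h.weights_sum x]
      refine tsum_congr fun U => ?_
      by_cases hw : w x U = 0
      · simp [hw]
      · have := cond_isProbabilityMeasure (μ := π) (s := (U : Set Ω))
          (hstar.trans_le (hU U hw)).ne'
        simp
    · refine Measure.le_iff.2 fun s hs => ?_
      rw [Measure.sum_apply _ hs]
      calc ∑' U : 𝒰 x, (w x U • ProbabilityTheory.cond π (U : Set Ω)) s
          ≤ ∑' U : 𝒰 x, w x U * ((piStar π 𝒰 w)⁻¹ * π s) := by
            refine ENNReal.tsum_le_tsum fun U => ?_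
            by_cases hw : w x U = 0
            · simp [hw]
            · rw [Measure.smul_apply, smul_eq_mul, cond_apply (h.measurable x U U.2)]
              gcongr
              · exact hU U hw
              · exact inter_subset_right
        _ = ((piStar π 𝒰 w)⁻¹ • π) s := by
            rw [ENNReal.tsum_mul_right, h.weights_sum, one_mul]; rfl

theorem piStar_le_one [IsProbabilityMeasure π] (h : IsMixture K π α 𝒰 w) : piStar π 𝒰 w ≤ 1 := by
  obtain ⟨x⟩ := nonempty_of_isProbabilityMeasure π
  obtain ⟨U, hU⟩ : ∃ U : 𝒰 x, w x U ≠ 0 := by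
    by_contra! hw
    have := h.weights_sum x
    simp [hw] at this
  exact (iInf₂_le (U : Set Ω) ⟨x, U.2, pos_iff_ne_zero.2 hU⟩).trans prob_le_one

/-- Positive dimension matters: in `ℝ^0` a point has Lebesgue measure `1`. -/
theorem nullSingletonClass_of_ambient_absolutelyContinuous [Nonempty (Fin d)]
    (hac : ambient π ≪ volume) : NullSingletonClass π where
  measure_singleton x := by
    have h0 : ambient π {(x : Fin d → ℝ)} = 0 := hac (measure_singleton _)
    rw [ambient, Measure.map_apply measurable_subtype_coe (measurableSet_singleton _)] at h0
    refine measure_mono_null (fun y hy => ?_) h0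
    simpa using congrArg Subtype.val (mem_singleton_iff.1 hy)

theorem IsHoldOrJump.apply_compl_le {S : Type*} [MeasurableSpace S] {K : Kernel S S}
    {π : Measure S} {a : S → ℝ} {C : ℝ≥0∞} (h : IsHoldOrJump K π a C) {s : Set S}
    (hs : MeasurableSet s) {x : S} (hx : x ∈ s) : K x sᶜ ≤ ENNReal.ofReal (1 - a x) := by
  obtain ⟨μ, hμ, -, e⟩ := h.exists_jump x
  rw [e]
  simp only [Measure.coe_add, Measure.coe_smul, Pi.add_apply, Pi.smul_apply, smul_eq_mul,
    Measure.dirac_apply' _ hs.compl]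
  simpa [hx] using mul_le_of_le_one_right' (a := ENNReal.ofReal (1 - a x))
    (prob_le_one (μ := μ) (s := sᶜ))

/-- If `K x` and `K y` are close in total variation and `π` has no atoms, then the holding
probabilities at `x` and `y` are close. -/
theorem IsHoldOrJump.holding_le {S : Type*} [MeasurableSpace S] [MeasurableSingletonClass S]
    {K : Kernel S S} {π : Measure S} [NullSingletonClass π] {a : S → ℝ} {C : ℝ≥0∞}
    (h : IsHoldOrJump K π a C) {x y : S} {ε : ℝ} (hε : 0 ≤ ε)
    (hxy : tvDist (K x) (K y) ≤ ENNReal.ofReal (min (a x) (a y) + ε)) : a x ≤ a y + ε := by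
  rcases eq_or_ne x y with rfl | hne
  · linarith
  have h1 : ENNReal.ofReal (a x) ≤ K x {x} := by
    obtain ⟨μ, hμ, -, e⟩ := h.exists_jump x
    rw [e]
    simp
  -- The test set `{x}` sees only the holding part of `K x`: without atoms, the jump law from `y`
  -- does not charge `x`.
  have h2 : K y {x} = 0 := by
    obtain ⟨μ, hμ, hle, e⟩ := h.exists_jump y
    have : μ {x} = 0 := le_antisymm ((hle {x}).trans (by simp)) zero_le
    rw [e]
    simp [this, hne.symm]
  have h3 : K x {x} - K y {x} ≤ tvDist (K x) (K y) :=
    le_iSup₂ (f := fun (A : Set S) (_ : MeasurableSet A) => K x A - K y A) {x}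
      (measurableSet_singleton x)
  rw [h2, tsub_zero] at h3
  have h4 := (ENNReal.ofReal_le_ofReal_iff (by
    have := h.half_le x; have := h.half_le y; positivity)).1 (h1.trans (h3.trans hxy))
  exact h4.trans (by gcongr; exact min_le_right _ _)

theorem exists_isOpen_measure_lt_half {S : Type*} [MeasurableSpace S] [PseudoMetricSpace S]
    [BorelSpace S] (π : Measure S) [IsFiniteMeasure π] [NullSingletonClass π] (x : S) :
    ∃ V, x ∈ V ∧ IsOpen V ∧ π V < 1 / 2 := by
  obtain ⟨V, hV, hVo, hlt⟩ := Set.exists_isOpen_lt_of_lt {x} (1 / 2 : ℝ≥0∞)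
    (μ := π) (by simp)
  exact ⟨V, singleton_subset_iff.1 hV, hVo, hlt⟩

/-- Take a small neighbourhood of a point all of whose neighbourhoods are charged. Such a set shows
that the lift cannot be mixed at time `0`. -/
theorem exists_measure_pos_le_half {S : Type*} [MeasurableSpace S] [PseudoMetricSpace S]
    [BorelSpace S] [SecondCountableTopology S] (π : Measure S) [IsProbabilityMeasure π]
    [NullSingletonClass π] : ∃ s, MeasurableSet s ∧ 0 < π s ∧ π s ≤ 1 / 2 := by
  obtain ⟨x, -, hx⟩ := exists_mem_forall_mem_nhdsWithin_pos_measure (μ := π) (s := univ)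
    (by simp)
  obtain ⟨V, hxV, hV, hlt⟩ := exists_isOpen_measure_lt_half π x
  exact ⟨V, hV.measurableSet, hx V (by simpa using hV.mem_nhds hxV), hlt.le⟩

/-- If every open set has positive measure, the holding probabilities are bounded by `1 - φ`,
because the flow out of a small neighbourhood of `x` is about `1 - a x` times its measure. -/
theorem IsHoldOrJump.holding_le_one_sub {S : Type*} [MeasurableSpace S] [PseudoMetricSpace S]
    [BorelSpace S] [MeasurableSingletonClass S] {K : Kernel S S} {π : Measure S}
    [IsProbabilityMeasure π] [NullSingletonClass π] [π.IsOpenPosMeasure] {a : S → ℝ} {C : ℝ≥0∞}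
    (h : IsHoldOrJump K π a C) {φ : ℝ} (hcond : HasConductance K π φ)
    (hcont : ∀ ε : ℝ, 0 < ε → ∃ δ : ℝ, 0 < δ ∧ ∀ x y : S, dist x y ≤ δ →
      tvDist (K x) (K y) ≤ ENNReal.ofReal (min (a x) (a y) + ε)) (x : S) : a x ≤ 1 - φ := by
  refine le_of_forall_pos_le_add fun ε hε => ?_
  obtain ⟨δ, hδ, hd⟩ := hcont ε hε
  obtain ⟨V, hxV, hV, hlt⟩ := exists_isOpen_measure_lt_half π x
  have ho : IsOpen (V ∩ Metric.ball x δ) := hV.inter Metric.isOpen_ball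
  have hpos : 0 < π (V ∩ Metric.ball x δ) :=
    ho.measure_pos π ⟨x, hxV, Metric.mem_ball_self hδ⟩
  have hfl := hcond _ ho.measurableSet ((measure_mono inter_subset_left).trans hlt.le)
  have hle : ENNReal.ofReal φ * π (V ∩ Metric.ball x δ) ≤
      ENNReal.ofReal (1 - a x + ε) * π (V ∩ Metric.ball x δ) := by
    refine hfl.trans ?_
    rw [← setLIntegral_const]
    refine setLIntegral_mono' ho.measurableSet fun y hy => ?_
    refine (h.apply_compl_le ho.measurableSet hy).trans (ENNReal.ofReal_le_ofReal ?_)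
    have := h.holding_le hε.le (hd x y (by rw [dist_comm]; exact (Metric.mem_ball.1 hy.2).le))
    linarith
  have hle' := (ENNReal.mul_le_mul_iff_left hpos.ne' (measure_ne_top _ _)).1 hle
  have := (ENNReal.ofReal_le_ofReal_iff (by linarith [h.le_one x])).1 hle'
  linarith

/-- A singleton is `π`-null, hence admissible whatever `β` is; only the supremum term of the bound
is kept. -/
theorem SmallSetBound.holding_le [NullSingletonClass π] {β c : ℝ} (h : SmallSetBound π α 𝒰 w β c) (x : Ω)
    (hα : 0 < α x) : α x ≤ c := by
  have h1 := h {x} (measurableSet_singleton x) (by simp)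
  have h2 : ENNReal.ofReal (α x) ≤ ⨆ y ∈ ({x} : Set Ω), ENNReal.ofReal (α y) :=
    le_iSup₂ (f := fun (y : Ω) (_ : y ∈ ({x} : Set Ω)) => ENNReal.ofReal (α y)) x rfl
  have h3 := h2.trans (le_add_self.trans h1)
  exact (ENNReal.ofReal_le_ofReal_iff'.1 h3).resolve_right hα.not_ge

end Representation

/-! ### Mixing times: degenerate case, attainment and the upper bound -/

theorem mixingTime_eq_zero_of_subsingleton {S : Type*} [MeasurableSpace S] [Subsingleton S]
    (K : Kernel S S) (π : Measure S) [IsProbabilityMeasure π] : mixingTime K π = 0 := by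
  have h0 : ∀ x, tvDist ((K ^ 0) x) π = 0 := fun x => by
    have hd : (K ^ 0) x = Measure.dirac x := by rw [pow_zero]; rfl
    rw [hd]
    refine le_antisymm (iSup₂_le fun s hs => ?_) zero_le
    rcases s.eq_empty_or_nonempty with rfl | hne
    · simp
    · rw [Subsingleton.eq_univ_of_nonempty hne]; simp
  have hlt : (⨆ x, tvDist ((K ^ 0) x) π) < 1 / 4 := by
    simp only [h0]; simp
  refine le_antisymm ?_ zero_le
  exact (iInf₂_le 0 hlt).trans (by simp)

/-- An infimum in `ℕ∞` is attained, and an index violating the mixing condition contributes `⊤`. -/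
theorem exists_of_mixingTime_ne_top {S : Type*} [MeasurableSpace S] {K : Kernel S S}
    {π : Measure S} (h : mixingTime K π ≠ ⊤) :
    ∃ T : ℕ, mixingTime K π = T ∧ (⨆ x, tvDist ((K ^ T) x) π) < 1 / 4 := by
  obtain ⟨T, hT⟩ := ENat.exists_eq_iInf fun t : ℕ =>
    ⨅ _ : (⨆ x : S, tvDist ((K ^ t) x) π) < 1 / 4, (t : ℕ∞)
  change _ = mixingTime K π at hT
  by_cases hlt : (⨆ x : S, tvDist ((K ^ T) x) π) < 1 / 4
  · exact ⟨T, by rw [← hT, iInf_pos hlt], hlt⟩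
  · rw [iInf_neg hlt] at hT
    exact absurd hT.symm h

theorem pow_le_exp_of_le_one_sub {a c L : ℝ} {n : ℕ} (ha : 0 ≤ a) (hac : a ≤ 1 - c)
    (hn : L ≤ c * n) : a ^ n ≤ Real.exp (-L) := by
  calc a ^ n ≤ Real.exp (-c) ^ n :=
        pow_le_pow_left₀ ha (hac.trans (Real.one_sub_le_exp_neg c)) n
    _ = Real.exp (-(c * n)) := by rw [← Real.exp_nat_mul]; congr 1; ring
    _ ≤ Real.exp (-L) := Real.exp_le_exp.2 (by linarith)

/-- Mixing time bound from conductance `φ` and holding probabilities at most `1 - c`. -/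
theorem IsHoldOrJump.exists_mixingTime_le {S : Type*} [MeasurableSpace S] {K : Kernel S S}
    [IsMarkovKernel K] {π : Measure S} [IsProbabilityMeasure π] {a : S → ℝ} {p : ℝ} (hp : 0 < p)
    (hp1 : p ≤ 1) (h : IsHoldOrJump K π a (ENNReal.ofReal p)⁻¹) {φ c : ℝ}
    (hcond : HasConductance K π φ) (hφ : 0 < φ) (hφ1 : φ ≤ 1) (hK : K.Invariant π) (hc : 0 < c)
    (hac : ∀ x, a x ≤ 1 - c) :
    ∃ N : ℕ, mixingTime K π ≤ N ∧
      N ≤ 2 * Real.log (4 / p) / c + 32 * Real.log (4 / p) / φ ^ 2 + 2 := by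
  set L := Real.log (4 / p) with hL
  have hL0 : 0 ≤ L := Real.log_nonneg (by rw [le_div_iff₀ hp]; linarith)
  have hexp : Real.exp (-(2 * L)) = p ^ 2 / 16 := by
    rw [show -(2 * L) = -L + -L by ring, Real.exp_add, Real.exp_neg, hL,
      Real.exp_log (by positivity)]
    field_simp; norm_num
  -- The choice of `n` gives `a x ^ n ≤ exp (-2L) = p²/16`. The choice of `m` gives `(1 - φ²/8)^m ≤
  -- exp (-4L)`, whose root is `p²/16` and absorbs the factor `1/p`. Each error is at most `1/16`.
  set n := ⌈2 * L / c⌉₊ with hn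
  set m := ⌈32 * L / φ ^ 2⌉₊ with hm
  have hn1 : 2 * L ≤ c * n := by
    have := Nat.le_ceil (2 * L / c)
    rw [div_le_iff₀ hc] at this; linarith
  have hm1 : 32 * L ≤ φ ^ 2 * m := by
    have := Nat.le_ceil (32 * L / φ ^ 2)
    rw [div_le_iff₀ (by positivity)] at this; linarith
  refine ⟨n + m, ?_, ?_⟩
  · have hlt : (⨆ x, tvDist ((K ^ (n + m)) x) π) < 1 / 4 := by
      have hsqrt : √((1 - φ ^ 2 / 8) ^ m) ≤ p ^ 2 / 16 := by
        refine Real.sqrt_le_iff.2 ⟨by positivity, ?_⟩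
        refine (pow_le_exp_of_le_one_sub (c := φ ^ 2 / 8) (L := 4 * L) (by nlinarith) le_rfl
          (by linarith)).trans (le_of_eq ?_)
        rw [← hexp, ← Real.exp_nat_mul]; congr 1; push_cast; ring
      have hbound : ∀ x, tvDist ((K ^ (n + m)) x) π ≤ ENNReal.ofReal (1 / 8) := fun x => by
        refine (h.tvDist_pow_le hcond hφ hφ1 hK x n m).trans ?_
        rw [← ENNReal.ofReal_inv_of_pos hp, ← ENNReal.ofReal_mul (by positivity),
          ← ENNReal.ofReal_add (pow_nonneg (by linarith [h.half_le x]) n) (by positivity)]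
        refine ENNReal.ofReal_le_ofReal ?_
        have h1 : a x ^ n ≤ 1 / 16 := by
          refine (pow_le_exp_of_le_one_sub (by linarith [h.half_le x]) (hac x) hn1).trans ?_
          rw [hexp]; nlinarith
        have h2 : p⁻¹ * √((1 - φ ^ 2 / 8) ^ m) ≤ 1 / 16 := by
          calc p⁻¹ * √((1 - φ ^ 2 / 8) ^ m) ≤ p⁻¹ * (p ^ 2 / 16) := by gcongr
            _ = p / 16 := by field_simp
            _ ≤ 1 / 16 := by linarith
        linarith
      refine (iSup_le hbound).trans_lt ?_
      rw [show (1 / 4 : ℝ≥0∞) = ENNReal.ofReal (1 / 4) by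
        rw [ENNReal.ofReal_div_of_pos (by norm_num)]; simp]
      exact (ENNReal.ofReal_lt_ofReal_iff (by norm_num)).2 (by norm_num)
    exact iInf₂_le (n + m) hlt
  · have h1 := Nat.ceil_lt_add_one (show 0 ≤ 2 * L / c by positivity)
    have h2 := Nat.ceil_lt_add_one (show 0 ≤ 32 * L / φ ^ 2 by positivity)
    push_cast
    linarith

end LiftedChains

/-! ### The lower bound for the mixing time of a lift -/

open LiftedChains in
theorem theorem3 {d : ℕ} (Ω : Set (Fin d → ℝ)) (hΩ : IsCompact Ω)
    (A B : Fin d → ℝ) (hAB : Ω ⊆ Set.pi Set.univ fun i => Set.Icc (A i) (B i))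
    (K : Kernel Ω Ω) [IsMarkovKernel K] (π : Measure Ω) [IsProbabilityMeasure π]
    (hrev : K.IsReversible π) (hac : ambient π ≪ volume)
    (α : (Fin d → ℝ) → ℝ) (𝒰 : (Fin d → ℝ) → Set (Set Ω)) (w : (Fin d → ℝ) → Set Ω → ℝ≥0∞)
    (hrep : IsMixture K π α 𝒰 w) (hstar : 0 < piStar π 𝒰 w)
    (β γ : ℝ) (hβ : β ∈ Set.Ioc (0 : ℝ) 1) (hγ : γ ∈ Set.Ioc (0 : ℝ) 1)
    (hsmall : (SmallSetBound π α 𝒰 w β γ ∧ π.IsOpenPosMeasure) ∨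
      SmallSetBound π α 𝒰 w β (1 - γ))
    (hcont : IsTVContinuous K α)
    (hdisc : DiscretizationErrorsVanish π A B α 𝒰 w)
    {Ω' : Type*} [MeasurableSpace Ω'] (K' : Kernel Ω' Ω') [IsMarkovKernel K']
    (π' : Measure Ω') [IsProbabilityMeasure π'] (hinv : K'.Invariant π')
    (hlift : IsLift K π K' π') :
    ENNReal.ofReal (√γ / (32 * √(Real.log (4 / (piStar π 𝒰 w).toReal) * Real.log (2 / √β)))) *
        (mixingTime K π : ℝ≥0∞) ^ (1 / 2 : ℝ) ≤ (mixingTime K' π' : ℝ≥0∞) := by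
  obtain ⟨hγ0, hγ1⟩ := hγ
  by_cases htop : mixingTime K' π' = ⊤
  · rw [htop]; exact le_top
  obtain ⟨T, hTeq, hT⟩ := exists_of_mixingTime_ne_top htop
  rw [hTeq]
  -- In dimension `0` the space is a single point, where `K` is mixed at time `0`.
  rcases isEmpty_or_nonempty (Fin d) with hd | hd
  · rw [mixingTime_eq_zero_of_subsingleton K π]
    simp
  have hK : K.Invariant π := hrev.invariant
  have := nullSingletonClass_of_ambient_absolutelyContinuous hac
  have hflow : ∀ s, MeasurableSet s → π s ≤ 1 / 2 → π s ≤ 4 * (T * ∫⁻ x in s, K x sᶜ ∂π) :=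
    fun s hs hs2 => measure_le_four_mul_flow_of_isLift hK hinv hlift hT hs hs2
  have hT1 : 1 ≤ T := by
    by_contra! h0
    obtain ⟨s, hs, hpos, hle⟩ := exists_measure_pos_le_half π
    have := hflow s hs hle
    simp only [Nat.lt_one_iff.1 h0, Nat.cast_zero, zero_mul, mul_zero] at this
    exact hpos.not_ge this
  have hT1' : (1 : ℝ) ≤ T := by exact_mod_cast hT1
  set φ : ℝ := 1 / (4 * T) with hφdef
  have hφ : 0 < φ := by positivity
  have hφ1 : φ ≤ 1 := by rw [hφdef, div_le_one (by positivity)]; linarith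
  have hcond : HasConductance K π φ := fun s hs hs2 => by
    calc ENNReal.ofReal φ * π s
        ≤ ENNReal.ofReal φ * (4 * (T * ∫⁻ x in s, K x sᶜ ∂π)) := by gcongr; exact hflow s hs hs2
      _ = ENNReal.ofReal (φ * (4 * T)) * ∫⁻ x in s, K x sᶜ ∂π := by
        rw [ENNReal.ofReal_mul hφ.le, ENNReal.ofReal_mul (by norm_num), ENNReal.ofReal_natCast,
          ENNReal.ofReal_ofNat]
        ring
      _ = ∫⁻ x in s, K x sᶜ ∂π := by
        rw [hφdef, one_div, inv_mul_cancel₀ (by positivity), ENNReal.ofReal_one, one_mul]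
  have hp1 := piStar_le_one hrep
  have hpne : piStar π 𝒰 w ≠ ⊤ := (hp1.trans_lt ENNReal.one_lt_top).ne
  set p := (piStar π 𝒰 w).toReal with hpdef
  have hp : 0 < p := ENNReal.toReal_pos hstar.ne' hpne
  have hp1' : p ≤ 1 := ENNReal.toReal_le_of_le_ofReal zero_le_one (by simpa using hp1)
  have hjump := hrep.isHoldOrJump hstar
  rw [← ENNReal.ofReal_toReal hpne] at hjump
  -- Both alternatives are weakened to a common bound: `1 - φ ≤ 1 - γφ` since `γ ≤ 1`, and `1 - γ ≤
  -- 1 - γφ` since `φ ≤ 1`.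
  have hac : ∀ x : Ω, α x ≤ 1 - γ * φ := fun x => by
    rcases hsmall with ⟨-, hopen⟩ | hb
    · have := hjump.holding_le_one_sub hcond hcont x
      nlinarith
    · have := hb.holding_le x (by linarith [(hrep.holding_mem x).1])
      nlinarith
  obtain ⟨N, hN, hNle⟩ := hjump.exists_mixingTime_le hp hp1' hcond hφ hφ1 hK
    (mul_pos hγ0 hφ) hac
  set L := Real.log (4 / p) with hLdef
  set L' := Real.log (2 / √β) with hLdef'
  have hlog2 := Real.log_two_gt_d9
  have hL : 1 ≤ L := by
    have h4 : Real.log 4 = 2 * Real.log 2 := by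
      rw [show (4 : ℝ) = 2 ^ 2 by norm_num, Real.log_pow]; norm_num
    have : Real.log 4 ≤ L := Real.log_le_log (by norm_num) (by rw [le_div_iff₀ hp]; linarith)
    linarith
  have hL' : 0.6 ≤ L' := by
    have hs : 0 < √β := Real.sqrt_pos.2 hβ.1
    have hs1 : √β ≤ 1 := Real.sqrt_le_one.2 hβ.2
    have : Real.log 2 ≤ L' := Real.log_le_log (by norm_num) (by rw [le_div_iff₀ hs]; linarith)
    linarith
  -- The terms are `8LT`, `512 L T² γ` and `2γ`. Since `L`, `T ≥ 1` and `γ ≤ 1`, they add up to at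
  -- most `522 L T²`; the constant `576` leaves room.
  have hγN : γ * N ≤ 576 * L * T ^ 2 := by
    have h1 : γ * (2 * L / (γ * φ) + 32 * L / φ ^ 2 + 2) =
        8 * L * T + 512 * L * T ^ 2 * γ + 2 * γ := by
      rw [hφdef]; field_simp; ring
    have h2 := mul_le_mul_of_nonneg_left hNle hγ0.le
    rw [h1] at h2
    have h3 : (T : ℝ) ≤ T ^ 2 := by nlinarith
    have h4 : L * T ≤ L * T ^ 2 := by gcongr
    have h5 : L * T ^ 2 * γ ≤ L * T ^ 2 := mul_le_of_le_one_right (by positivity) hγ1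
    nlinarith
  have hreal : √γ / (32 * √(L * L')) * √N ≤ T := by
    rw [div_mul_eq_mul_div, div_le_iff₀ (by positivity), ← Real.sqrt_mul hγ0.le]
    refine Real.sqrt_le_iff.2 ⟨by positivity, hγN.trans ?_⟩
    rw [mul_pow, mul_pow, Real.sq_sqrt (by positivity)]
    have : 0 ≤ (T : ℝ) ^ 2 * L := by positivity
    -- This uses `32² * 0.6 = 614.4 ≥ 576`, with `0.6` the lower bound for `L'`.
    nlinarith
  calc ENNReal.ofReal (√γ / (32 * √(L * L'))) * (mixingTime K π : ℝ≥0∞) ^ (1 / 2 : ℝ)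
      ≤ ENNReal.ofReal (√γ / (32 * √(L * L'))) * (N : ℝ≥0∞) ^ (1 / 2 : ℝ) := by
        gcongr; exact_mod_cast ENat.toENNReal_le.2 hN
    _ = ENNReal.ofReal (√γ / (32 * √(L * L')) * √N) := by
        rw [ENNReal.ofReal_mul (by positivity), Real.sqrt_eq_rpow (N : ℝ),
          ← ENNReal.ofReal_rpow_of_nonneg (by positivity) (by norm_num), ENNReal.ofReal_natCast]
    _ ≤ ENNReal.ofReal T := ENNReal.ofReal_le_ofReal hreal
    _ = _ := by rw [ENNReal.ofReal_natCast]; rfl
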